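/- Let $n\ge 0$ be an integer and let $\lambda$ be a partition of $n$. A $\lambda$-tableau $t$ is a bijective filling of the Young diagram of $\lambda$ with the numbers $1,\dots,n$; the symmetric group $\mathfrak S_n$ acts on $\lambda$-tableaux by permuting the entries. Let $R_t$ and $C_t$ be the subgroups of $\mathfrak S_n$ fixing every row, respectively every column, of $t$ setwise, and let $\{t\}=\{\sigma t:\sigma\in R_t\}$ be the tabloid of $t$. Let $M^\lambda_{\mathbb Z}$ be the permutation $\mathbb Z\mathfrak S_n$-lattice with $\mathbb Z$-basis the set of $\lambda$-tabloids, let $e_t=\sum_{\sigma\in C_t}\operatorname{sgn}(\sigma)\{\sigma t\}\in M^\lambda_{\mathbb Z}$ be the polytabloid of $t$, and let the Specht lattice $S^\lambda_{\mathbb Z}\subseteq M^\lambda_{\mathbb Z}$ be the $\mathbb Z\mathfrak S_n$-sublattice spanned over $\mathbb Z$ by all polytabloids (equivalently, generated over $\mathbb Z\mathfrak S_n$ by any one of them). Let $(S^\lambda_{\mathbb Z})^*=\operatorname{Hom}_{\mathbb Z}(S^\lambda_{\mathbb Z},\mathbb Z)$ be the dual lattice, with $(\sigma f)(x)=f(\sigma^{-1}x)$.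 For a $\lambda$-tableau $s$ let $\{s\}^*\in (M^\lambda_{\mathbb Z})^*$ be the linear form taking an element to its coefficient at the basis element $\{s\}$. **Theorem (Wildon).** There is an injective $\mathbb Z\mathfrak S_n$-homomorphism $$\varphi:(S^\lambda_{\mathbb Z})^*\to S^\lambda_{\mathbb Z}$$ such that $$\varphi\bigl(\{s\}^*|_{S^\lambda_{\mathbb Z}}\bigr)=\sum_{\sigma\in R_s}e_{\sigma s}\qquad\text{for every }\lambda\text{-tableau } s.$$ -/

import Mathlib

noncomputable section

namespace SpechtLattice

open Equiv MonoidAlgebra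

/-- The Young diagram of a partition `lam` of `n`: its rows, from top to bottom, have as lengths
the parts of `lam` in weakly decreasing order. -/
def diagram {n : ℕ} (lam : n.Partition) : YoungDiagram :=
  YoungDiagram.ofRowLens (lam.parts.sort (· ≥ ·)) (lam.parts.pairwise_sort (· ≥ ·)).sortedGE

/-- A tableau of shape `μ` with entries `0, …, n - 1`, each occurring exactly once. Cells are pairs
(row, column), and `t c` is the entry of `t` in the cell `c`. -/
def Tableau (μ : YoungDiagram) (n : ℕ) : Type := {c : ℕ × ℕ // c ∈ μ} ≃ Fin n

namespace Tableau

variable {μ : YoungDiagram} {n : ℕ}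

/-- The entry of `t` in a given cell. -/
def entry (t : Tableau μ n) : {c : ℕ × ℕ // c ∈ μ} ≃ Fin n := t

/-- The row of `t` that contains the number `x`. -/
def row (t : Tableau μ n) (x : Fin n) : ℕ := (t.entry.symm x).1.1

/-- The column of `t` that contains the number `x`. -/
def col (t : Tableau μ n) (x : Fin n) : ℕ := (t.entry.symm x).1.2

/-- The symmetric group acts on tableaux by permuting the entries. -/
instance : MulAction (Perm (Fin n)) (Tableau μ n) where
  smul σ t := t.entry.trans σ
  one_smul _ := Equiv.ext fun _ => rfl
  mul_smul _ _ _ := Equiv.ext fun _ => rfl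

theorem entry_smul (σ : Perm (Fin n)) (t : Tableau μ n) (c : {c : ℕ × ℕ // c ∈ μ}) :
    (σ • t).entry c = σ (t.entry c) := rfl

theorem row_smul (σ : Perm (Fin n)) (t : Tableau μ n) (x : Fin n) :
    (σ • t).row x = t.row (σ⁻¹ x) := rfl

theorem col_smul (σ : Perm (Fin n)) (t : Tableau μ n) (x : Fin n) :
    (σ • t).col x = t.col (σ⁻¹ x) := rfl

/-- The row stabilizer `R_t`: the permutations fixing every row of `t` setwise. -/
def rowStabilizer (t : Tableau μ n) : Subgroup (Perm (Fin n)) where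
  carrier := {σ | ∀ x, t.row (σ x) = t.row x}
  one_mem' _ := rfl
  mul_mem' {σ τ} hσ hτ x := (hσ (τ x)).trans (hτ x)
  inv_mem' {σ} hσ x := by
    have h := hσ (σ⁻¹ x)
    simpa using h.symm

/-- The column stabilizer `C_t`: the permutations fixing every column of `t` setwise. -/
def colStabilizer (t : Tableau μ n) : Subgroup (Perm (Fin n)) where
  carrier := {σ | ∀ x, t.col (σ x) = t.col x}
  one_mem' _ := rfl
  mul_mem' {σ τ} hσ hτ x := (hσ (τ x)).trans (hτ x)
  inv_mem' {σ} hσ x := by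
    have h := hσ (σ⁻¹ x)
    simpa using h.symm

theorem mem_rowStabilizer {t : Tableau μ n} {σ : Perm (Fin n)} :
    σ ∈ t.rowStabilizer ↔ ∀ x, t.row (σ x) = t.row x := Iff.rfl

theorem mem_colStabilizer {t : Tableau μ n} {σ : Perm (Fin n)} :
    σ ∈ t.colStabilizer ↔ ∀ x, t.col (σ x) = t.col x := Iff.rfl

instance (t : Tableau μ n) : DecidablePred (· ∈ t.rowStabilizer) := fun σ =>
  inferInstanceAs (Decidable (∀ x, t.row (σ x) = t.row x))

instance (t : Tableau μ n) : DecidablePred (· ∈ t.colStabilizer) := fun σ =>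
  inferInstanceAs (Decidable (∀ x, t.col (σ x) = t.col x))

theorem conj_mem_rowStabilizer {t : Tableau μ n} {σ : Perm (Fin n)} (π : Perm (Fin n)) :
    π * σ * π⁻¹ ∈ (π • t).rowStabilizer ↔ σ ∈ t.rowStabilizer := by
  simp only [mem_rowStabilizer, row_smul, Perm.mul_apply]
  exact ⟨fun h x => by simpa using h (π x), fun h x => by simpa using h (π⁻¹ x)⟩

theorem conj_mem_colStabilizer {t : Tableau μ n} {σ : Perm (Fin n)} (π : Perm (Fin n)) :
    π * σ * π⁻¹ ∈ (π • t).colStabilizer ↔ σ ∈ t.colStabilizer := by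
  simp only [mem_colStabilizer, col_smul, Perm.mul_apply]
  exact ⟨fun h x => by simpa using h (π x), fun h x => by simpa using h (π⁻¹ x)⟩

end Tableau

/-- Two tableaux `t`, `u` are row equivalent if `u = σ t` for some `σ` in the row stabilizer
of `t`. -/
def rowSetoid (μ : YoungDiagram) (n : ℕ) : Setoid (Tableau μ n) where
  r t u := ∃ σ ∈ t.rowStabilizer, u = σ • t
  iseqv :=
    { refl := fun t => ⟨1, one_mem _, (one_smul _ t).symm⟩
      symm := by
        rintro t _ ⟨σ, hσ, rfl⟩
        refine ⟨σ⁻¹, ?_, (inv_smul_smul σ t).symm⟩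
        have := (Tableau.conj_mem_rowStabilizer (t := t) (σ := σ⁻¹) σ).2 (inv_mem hσ)
        simpa using this
      trans := by
        rintro t _ _ ⟨σ, hσ, rfl⟩ ⟨τ, hτ, rfl⟩
        refine ⟨τ * σ, ?_, (mul_smul τ σ t).symm⟩
        have h : σ⁻¹ * τ * σ ∈ t.rowStabilizer := by
          rw [← Tableau.conj_mem_rowStabilizer σ]
          simpa [mul_assoc] using hτ
        simpa [mul_assoc] using mul_mem hσ h }

/-- Tabloids of shape `μ`: the row equivalence classes `{t} = {σ t : σ ∈ R_t}` of tableaux. -/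
def Tabloid (μ : YoungDiagram) (n : ℕ) : Type := Quotient (rowSetoid μ n)

/-- The tabloid `{t}` of a tableau `t`. -/
def Tableau.tabloid {μ : YoungDiagram} {n : ℕ} (t : Tableau μ n) : Tabloid μ n :=
  Quotient.mk (rowSetoid μ n) t

variable {μ : YoungDiagram} {n : ℕ}

/-- The action of the symmetric group on tabloids: `σ {t} = {σ t}`. -/
instance : MulAction (Perm (Fin n)) (Tabloid μ n) where
  smul π := Quotient.map (π • ·) <| by
    rintro t _ ⟨σ, hσ, rfl⟩
    refine ⟨π * σ * π⁻¹, (Tableau.conj_mem_rowStabilizer π).2 hσ, ?_⟩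
    simp [mul_smul]
  one_smul := by
    rintro ⟨t⟩
    exact congrArg Tableau.tabloid (one_smul _ t)
  mul_smul σ τ := by
    rintro ⟨t⟩
    exact congrArg Tableau.tabloid (mul_smul σ τ t)

theorem smul_tabloid (σ : Perm (Fin n)) (t : Tableau μ n) :
    σ • t.tabloid = (σ • t).tabloid := rfl

/-- The Young permutation lattice `M` of shape `μ`: the free abelian group on the set of
tabloids, with the symmetric group permuting the basis. -/
abbrev youngLattice (μ : YoungDiagram) (n : ℕ) :
    Representation ℤ (Perm (Fin n)) (MonoidAlgebra ℤ (Tabloid μ n)) :=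
  Representation.ofMulAction ℤ (Perm (Fin n)) (Tabloid μ n)

/-- The polytabloid `e_t = ∑_{σ ∈ C_t} sgn(σ) {σ t}`. -/
def polytabloid (t : Tableau μ n) : MonoidAlgebra ℤ (Tabloid μ n) :=
  ∑ σ : t.colStabilizer, single (σ.1 • t).tabloid (Perm.sign σ.1 : ℤ)

/-- `π e_t = e_{π t}`. -/
theorem youngLattice_polytabloid (π : Perm (Fin n)) (t : Tableau μ n) :
    youngLattice μ n π (polytabloid t) = polytabloid (π • t) := by
  simp only [polytabloid, map_sum, Representation.ofMulAction_single, smul_tabloid]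
  refine Fintype.sum_equiv ⟨fun σ => ⟨π * σ.1 * π⁻¹, (Tableau.conj_mem_colStabilizer π).2 σ.2⟩,
    fun σ => ⟨π⁻¹ * σ.1 * π, (Tableau.conj_mem_colStabilizer π).1
      (by simp [mul_assoc])⟩, fun σ => ?_, fun σ => ?_⟩ _ _ fun σ => ?_
  · simp [mul_assoc]
  · simp [mul_assoc]
  · have h : Perm.sign (π * σ.1 * π⁻¹) = Perm.sign σ.1 := by
      rw [Perm.sign_mul, Perm.sign_mul, Perm.sign_inv, mul_right_comm, Int.units_mul_self, one_mul]
    simp only [Equiv.coe_fn_mk, h]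
    simp [mul_smul]

/-- The Specht lattice `S` of shape `μ`: the sublattice of the Young permutation lattice spanned
by all polytabloids. By `specht_eq_cyclic` it is the cyclic submodule over the integral group ring
generated by any single polytabloid. -/
def specht (μ : YoungDiagram) (n : ℕ) : Subrepresentation (youngLattice μ n) where
  toSubmodule := Submodule.span ℤ (Set.range polytabloid)
  apply_mem_toSubmodule π v hv := by
    induction hv using Submodule.span_induction with
    | mem x hx =>
      obtain ⟨t, rfl⟩ := hx
      rw [youngLattice_polytabloid]
      exact Submodule.subset_span ⟨_, rfl⟩
    | zero => simp
    | add x y _ _ hx hy => rw [map_add]; exact add_mem hx hy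
    | smul a x _ hx => rw [map_smul]; exact Submodule.smul_mem _ a hx

theorem specht_eq_cyclic (t : Tableau μ n) :
    (specht μ n).toSubmodule =
      Submodule.span ℤ (Set.range fun π : Perm (Fin n) => youngLattice μ n π (polytabloid t)) := by
  have h : Set.range (polytabloid (μ := μ) (n := n)) =
      Set.range fun π : Perm (Fin n) => youngLattice μ n π (polytabloid t) := by
    ext x
    constructor
    · rintro ⟨u, rfl⟩
      refine ⟨t.entry.symm.trans u.entry, ?_⟩
      simp only [youngLattice_polytabloid]
      congr 1
      refine Equiv.ext fun c => ?_
      change u.entry (t.entry.symm (t.entry c)) = u.entry c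
      rw [Equiv.symm_apply_apply]
    · rintro ⟨π, rfl⟩
      exact ⟨π • t, (youngLattice_polytabloid π t).symm⟩
  change Submodule.span ℤ (Set.range polytabloid) = _
  rw [h]

/-- The underlying abelian group of the Specht lattice. -/
abbrev SpechtSpace (μ : YoungDiagram) (n : ℕ) : Type := (specht μ n).toSubmodule

/-- The action of the symmetric group on the Specht lattice. -/
abbrev spechtRep (μ : YoungDiagram) (n : ℕ) :
    Representation ℤ (Perm (Fin n)) (SpechtSpace μ n) :=
  (specht μ n).toRepresentation

/-- The dual tabloid `{t}^*`: the linear form on the Young permutation lattice that takes an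
element to its coefficient at the basis element `{t}`. -/
def dualTabloid (t : Tableau μ n) : Module.Dual ℤ (MonoidAlgebra ℤ (Tabloid μ n)) :=
  Finsupp.lapply t.tabloid ∘ₗ (coeffLinearEquiv ℤ).toLinearMap

/-- The restriction of the dual tabloid `{t}^*` to the Specht lattice. -/
def dualTabloidRestrict (t : Tableau μ n) : Module.Dual ℤ (SpechtSpace μ n) :=
  (dualTabloid t).domRestrict (specht μ n).toSubmodule

end SpechtLattice

end

noncomputable section

namespace SpechtLattice

open Equiv MonoidAlgebra

variable {μ : YoungDiagram} {n : ℕ}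

/-! Put `φ(f) = ∑ f(e_t) e_t`, with one tableau `t` from each column equivalence class. Replacing
`t` by `σ t` with `σ ∈ C_t` multiplies `e_t` by `sgn σ`, which enters `f(e_t) e_t` twice and
cancels; hence no choice matters (`evalSmul_eq_of_mk_eq`), and equivariance follows because `𝔖_n`
permutes the classes. Injectivity is positivity: `f(φ(f)) = ∑ f(e_t)²`, so `φ(f) = 0` forces `f` to
vanish on all polytabloids, which span. For `f = {s}^*`, the coefficient `f(e_t)` is the sum of `sgn
σ` over `σ ∈ C_t` with `{σ t} = {s}`, and `sgn(σ) e_t = e_{σ t}`. So each class contributes its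
`e_u` with `{u} = {s}`; over all classes these `u` are exactly the `σ s` with `σ ∈ R_s`. -/

instance : Finite (Tableau μ n) :=
  haveI : Finite {c : ℕ × ℕ // c ∈ μ} := μ.cells.finite_toSet
  inferInstanceAs (Finite ({c : ℕ × ℕ // c ∈ μ} ≃ Fin n))

instance : Fintype (Tableau μ n) := Fintype.ofFinite _

theorem Tableau.smul_left_injective (t : Tableau μ n) :
    Function.Injective fun σ : Perm (Fin n) => σ • t := by
  intro σ τ h
  ext x
  have := congrArg (fun u : Tableau μ n => u.entry (t.entry.symm x)) h
  simp only [Tableau.entry_smul, Equiv.apply_symm_apply] at this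
  rw [this]

theorem Tableau.exists_smul_eq (t u : Tableau μ n) : ∃ σ : Perm (Fin n), σ • t = u := by
  refine ⟨t.entry.symm.trans u.entry, Equiv.ext fun c => ?_⟩
  change u.entry (t.entry.symm (t.entry c)) = u.entry c
  rw [Equiv.symm_apply_apply]

theorem Tableau.col_smul_eq_col_iff {t : Tableau μ n} {σ : Perm (Fin n)} :
    (σ • t).col = t.col ↔ σ ∈ t.colStabilizer := by
  rw [← inv_mem_iff, Tableau.mem_colStabilizer, funext_iff]
  rfl

theorem Tableau.tabloid_eq_tabloid_iff {t u : Tableau μ n} :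
    u.tabloid = t.tabloid ↔ ∃ σ ∈ t.rowStabilizer, u = σ • t :=
  eq_comm.trans Quotient.eq

theorem Tableau.tabloid_smul_eq_tabloid_iff {t : Tableau μ n} {σ : Perm (Fin n)} :
    (σ • t).tabloid = t.tabloid ↔ σ ∈ t.rowStabilizer := by
  rw [Tableau.tabloid_eq_tabloid_iff]
  refine ⟨?_, fun h => ⟨σ, h, rfl⟩⟩
  rintro ⟨τ, hτ, h⟩
  exact t.smul_left_injective h ▸ hτ

/-- The permutations in a subgroup correspond to the tableaux they carry `t` to. -/
def Tableau.subgroupEquiv (t : Tableau μ n) (H : Subgroup (Perm (Fin n)))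
    (P : Tableau μ n → Prop) (hP : ∀ σ : Perm (Fin n), P (σ • t) ↔ σ ∈ H) :
    H ≃ {u : Tableau μ n // P u} :=
  Equiv.ofBijective (fun σ => ⟨σ.1 • t, (hP σ.1).2 σ.2⟩)
    ⟨fun _ _ h => Subtype.ext (t.smul_left_injective (congrArg Subtype.val h)), fun u => by
      obtain ⟨σ, hσ⟩ := t.exists_smul_eq u.1
      exact ⟨⟨σ, (hP σ).1 (hσ ▸ u.2)⟩, Subtype.ext hσ⟩⟩

theorem Tableau.colStabilizer_smul {t : Tableau μ n} {σ : Perm (Fin n)}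
    (hσ : σ ∈ t.colStabilizer) : (σ • t).colStabilizer = t.colStabilizer := by
  ext τ
  rw [Tableau.mem_colStabilizer, Tableau.mem_colStabilizer, Tableau.col_smul_eq_col_iff.2 hσ]

/-- With the stabilizer in a filter rather than in the index type, `C_{σ t}` can be rewritten to
`C_t` without dependent-type trouble. -/
theorem polytabloid_eq_sum_filter (t : Tableau μ n) :
    polytabloid t = ∑ σ : Perm (Fin n) with σ ∈ t.colStabilizer,
      single (σ • t).tabloid (Perm.sign σ : ℤ) := by
  rw [polytabloid, ← Finset.sum_subtype (p := (· ∈ t.colStabilizer)) {σ | σ ∈ t.colStabilizer}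
    (by simp) fun σ : Perm (Fin n) => single (σ • t).tabloid (Perm.sign σ : ℤ)]

/-- Column permutations act on a polytabloid by their sign. -/
theorem polytabloid_smul_of_mem {t : Tableau μ n} {σ : Perm (Fin n)}
    (hσ : σ ∈ t.colStabilizer) :
    polytabloid (σ • t) = (Perm.sign σ : ℤ) • polytabloid t := by
  rw [polytabloid_eq_sum_filter, polytabloid_eq_sum_filter, Finset.smul_sum]
  simp only [Tableau.colStabilizer_smul hσ]
  -- Substitute `τ ↦ τ σ`, a bijection of `C_t`; then `sgn τ = sgn σ · sgn(τ σ)`.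
  refine Finset.sum_equiv (Equiv.mulRight σ) (fun τ => ?_) fun τ _ => ?_
  · simp [Subgroup.mul_mem_cancel_right _ hσ]
  · rw [Equiv.coe_mulRight, mul_smul, smul_single, smul_eq_mul, Perm.sign_mul, mul_comm]
    push_cast
    rw [mul_assoc, ← Units.val_mul, Int.units_mul_self, Units.val_one, mul_one]

/-- The polytabloid of `t`, as an element of the Specht lattice. -/
def spechtPolytabloid (t : Tableau μ n) : SpechtSpace μ n :=
  ⟨polytabloid t, Submodule.subset_span ⟨t, rfl⟩⟩

theorem spechtPolytabloid_smul_of_mem {t : Tableau μ n} {σ : Perm (Fin n)}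
    (hσ : σ ∈ t.colStabilizer) :
    spechtPolytabloid (σ • t) = (Perm.sign σ : ℤ) • spechtPolytabloid t :=
  Subtype.ext (polytabloid_smul_of_mem hσ)

theorem spechtRep_spechtPolytabloid (π : Perm (Fin n)) (t : Tableau μ n) :
    spechtRep μ n π (spechtPolytabloid t) = spechtPolytabloid (π • t) :=
  Subtype.ext (youngLattice_polytabloid π t)

theorem span_range_spechtPolytabloid :
    Submodule.span ℤ (Set.range (spechtPolytabloid (μ := μ) (n := n))) = ⊤ := by
  refine Submodule.map_injective_of_injective (specht μ n).toSubmodule.injective_subtype ?_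
  rw [Submodule.map_span, ← Set.range_comp, Submodule.map_subtype_top]
  rfl

/-- Two tableaux are column equivalent if each number is in the same column of both. -/
def colSetoid (μ : YoungDiagram) (n : ℕ) : Setoid (Tableau μ n) := Setoid.ker Tableau.col

/-- The column equivalence classes of tableaux. -/
abbrev ColClass (μ : YoungDiagram) (n : ℕ) : Type := Quotient (colSetoid μ n)

instance : Fintype (ColClass μ n) := Fintype.ofFinite _

/-- The symmetric group permutes the column equivalence classes. -/
def colClassPerm (π : Perm (Fin n)) : Perm (ColClass μ n) :=
  Quotient.congr (MulAction.toPerm π) fun t u => by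
    change t.col = u.col ↔ (π • t).col = (π • u).col
    simp only [funext_iff, Tableau.col_smul]
    exact ⟨fun h x => h _, fun h x => by simpa using h (π x)⟩

theorem colClassPerm_mk (π : Perm (Fin n)) (t : Tableau μ n) :
    colClassPerm π (Quotient.mk (colSetoid μ n) t) = Quotient.mk (colSetoid μ n) (π • t) := rfl

/-- The element `f(e_t) e_t` of the Specht lattice. -/
def evalSmul (f : Module.Dual ℤ (SpechtSpace μ n)) (t : Tableau μ n) : SpechtSpace μ n :=
  f (spechtPolytabloid t) • spechtPolytabloid t

theorem evalSmul_eq_of_mk_eq (f : Module.Dual ℤ (SpechtSpace μ n)) {t u : Tableau μ n}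
    (h : Quotient.mk (colSetoid μ n) t = Quotient.mk (colSetoid μ n) u) :
    evalSmul f t = evalSmul f u := by
  obtain ⟨σ, rfl⟩ := u.exists_smul_eq t
  have hσ : σ ∈ u.colStabilizer := Tableau.col_smul_eq_col_iff.1 (Quotient.exact h)
  rw [evalSmul, spechtPolytabloid_smul_of_mem hσ, map_smul, smul_smul, smul_eq_mul, mul_right_comm,
    ← Units.val_mul, Int.units_mul_self, Units.val_one, one_mul, evalSmul]

theorem evalSmul_out (f : Module.Dual ℤ (SpechtSpace μ n)) (t : Tableau μ n) :
    evalSmul f (Quotient.mk (colSetoid μ n) t).out = evalSmul f t :=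
  evalSmul_eq_of_mk_eq f (Quotient.out_eq _)

/-- The map `f ↦ ∑ f(e_t) e_t` from the dual of the Specht lattice to the Specht lattice, the sum
being over representatives `t` of the column equivalence classes. -/
def dualToSpecht (μ : YoungDiagram) (n : ℕ) :
    Module.Dual ℤ (SpechtSpace μ n) →ₗ[ℤ] SpechtSpace μ n where
  toFun f := ∑ q : ColClass μ n, evalSmul f q.out
  map_add' f g := by
    simp only [evalSmul, LinearMap.add_apply, add_smul, Finset.sum_add_distrib]
  map_smul' a f := by
    simp only [evalSmul, LinearMap.smul_apply, smul_assoc, Finset.smul_sum, RingHom.id_apply]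

theorem dualToSpecht_apply (f : Module.Dual ℤ (SpechtSpace μ n)) :
    dualToSpecht μ n f = ∑ q : ColClass μ n, evalSmul f q.out := rfl

/-- Applying `f` to its own image gives a sum of integer squares. -/
theorem dualToSpecht_injective : Function.Injective (dualToSpecht μ n) := by
  rw [injective_iff_map_eq_zero]
  intro f hf
  have h : ∑ q : ColClass μ n, f (spechtPolytabloid q.out) * f (spechtPolytabloid q.out) = 0 := by
    simpa only [dualToSpecht_apply, evalSmul, map_sum, map_smul, smul_eq_mul, map_zero]
      using congrArg f hf
  rw [Finset.sum_eq_zero_iff_of_nonneg fun _ _ => mul_self_nonneg _] at h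
  refine LinearMap.ext_on_range span_range_spechtPolytabloid fun t => ?_
  -- This is `f(e_t)²`; it depends only on the column class of `t`, so it may be computed at the
  -- chosen representative.
  have ht : f (evalSmul f t) = 0 := by
    rw [← evalSmul_out, evalSmul, map_smul, smul_eq_mul]
    exact h _ (Finset.mem_univ _)
  rwa [evalSmul, map_smul, smul_eq_mul, mul_self_eq_zero] at ht

theorem evalSmul_dual_smul (π : Perm (Fin n)) (f : Module.Dual ℤ (SpechtSpace μ n))
    (t : Tableau μ n) :
    evalSmul ((spechtRep μ n).dual π f) (π • t) = spechtRep μ n π (evalSmul f t) := by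
  have h : (spechtRep μ n).dual π f (spechtPolytabloid (π • t)) = f (spechtPolytabloid t) := by
    change f (spechtRep μ n π⁻¹ (spechtPolytabloid (π • t))) = _
    rw [spechtRep_spechtPolytabloid, inv_smul_smul]
  rw [evalSmul, h, evalSmul, map_smul, spechtRep_spechtPolytabloid]

theorem dualToSpecht_dual (π : Perm (Fin n)) (f : Module.Dual ℤ (SpechtSpace μ n)) :
    dualToSpecht μ n ((spechtRep μ n).dual π f) = spechtRep μ n π (dualToSpecht μ n f) := by
  rw [dualToSpecht_apply, dualToSpecht_apply, map_sum]
  refine (Fintype.sum_equiv (colClassPerm π) _ _ fun q => ?_).symm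
  induction q using Quotient.inductionOn with
  | h t => rw [colClassPerm_mk, evalSmul_out, evalSmul_out, evalSmul_dual_smul]

theorem dualTabloid_single (s : Tableau μ n) (T : Tabloid μ n) (a : ℤ) [Decidable (T = s.tabloid)] :
    dualTabloid s (single T a) = if T = s.tabloid then a else 0 := by
  classical
  change (Finsupp.single T a) s.tabloid = _
  rw [Finsupp.single_apply]

/-- On a column equivalence class, `{s}^*(e_t) e_t` collects the polytabloids `e_u` with
`{u} = {s}`. -/
theorem dualTabloid_smul_polytabloid [DecidableEq (Tabloid μ n)] [DecidableEq (ColClass μ n)]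
    (s t : Tableau μ n) :
    dualTabloid s (polytabloid t) • polytabloid t =
      ∑ u : {u : Tableau μ n // Quotient.mk (colSetoid μ n) u = Quotient.mk (colSetoid μ n) t},
        if u.1.tabloid = s.tabloid then polytabloid u.1 else 0 := by
  -- `C_t` acts simply transitively on the column class of `t`.
  rw [← Equiv.sum_comp (t.subgroupEquiv t.colStabilizer _
    fun σ => Quotient.eq.trans Tableau.col_smul_eq_col_iff)]
  -- Only the `e_t` inside the coefficient is expanded; the outer one stays whole to absorb each
  -- sign.
  conv_lhs => enter [1]; rw [polytabloid]
  rw [map_sum, Finset.sum_smul]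
  refine Finset.sum_congr rfl fun σ _ => ?_
  change _ = if (σ.1 • t).tabloid = s.tabloid then polytabloid (σ.1 • t) else 0
  rw [dualTabloid_single, ite_smul, zero_smul, polytabloid_smul_of_mem σ.2]

theorem dualToSpecht_dualTabloidRestrict (s : Tableau μ n) :
    (dualToSpecht μ n (dualTabloidRestrict s) : MonoidAlgebra ℤ (Tabloid μ n)) =
      ∑ σ : s.rowStabilizer, polytabloid (σ.1 • s) := by
  classical
  calc (dualToSpecht μ n (dualTabloidRestrict s) : MonoidAlgebra ℤ (Tabloid μ n))
    _ = ∑ q : ColClass μ n, dualTabloid s (polytabloid q.out) • polytabloid q.out := by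
      rw [dualToSpecht_apply, Submodule.coe_sum]
      rfl
    _ = ∑ q : ColClass μ n, ∑ u : {u : Tableau μ n // Quotient.mk (colSetoid μ n) u = q},
          if u.1.tabloid = s.tabloid then polytabloid u.1 else 0 := by
      refine Finset.sum_congr rfl fun q _ => ?_
      induction q using Quotient.inductionOn with
      | h t =>
        rw [← dualTabloid_smul_polytabloid]
        exact congrArg Subtype.val (evalSmul_out (dualTabloidRestrict s) t)
    _ = ∑ u : Tableau μ n, if u.tabloid = s.tabloid then polytabloid u else 0 := by
      -- The column classes partition the tableaux, so the double sum runs over each tableau once.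
      convert Fintype.sum_fiberwise (fun u : Tableau μ n => Quotient.mk (colSetoid μ n) u)
        fun u : Tableau μ n => if u.tabloid = s.tabloid then polytabloid u else 0
    _ = ∑ u : {u : Tableau μ n // u.tabloid = s.tabloid}, polytabloid u.1 := by
      rw [← Finset.sum_filter, Finset.sum_subtype _ (p := fun u => u.tabloid = s.tabloid) (by simp)]
    _ = ∑ σ : s.rowStabilizer, polytabloid (σ.1 • s) :=
      (Equiv.sum_comp (s.subgroupEquiv s.rowStabilizer _
        fun σ => Tableau.tabloid_smul_eq_tabloid_iff) _).symm

/-- `dualToSpecht` as a homomorphism of representations. -/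
def dualIntertwining (μ : YoungDiagram) (n : ℕ) :
    Representation.IntertwiningMap (spechtRep μ n).dual (spechtRep μ n) where
  toLinearMap := dualToSpecht μ n
  isIntertwining' π := LinearMap.ext (dualToSpecht_dual π)

end SpechtLattice

end

theorem theoremA10 (n : ℕ) (lam : n.Partition) :
    ∃ φ : Representation.IntertwiningMap
        (SpechtLattice.spechtRep (SpechtLattice.diagram lam) n).dual
        (SpechtLattice.spechtRep (SpechtLattice.diagram lam) n),
      Function.Injective φ ∧
      ∀ s : SpechtLattice.Tableau (SpechtLattice.diagram lam) n,
        (φ (SpechtLattice.dualTabloidRestrict s) :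
            MonoidAlgebra ℤ (SpechtLattice.Tabloid (SpechtLattice.diagram lam) n)) =
          ∑ σ : s.rowStabilizer, SpechtLattice.polytabloid (σ.1 • s) :=
  ⟨SpechtLattice.dualIntertwining _ n, SpechtLattice.dualToSpecht_injective,
    SpechtLattice.dualToSpecht_dualTabloidRestrict⟩
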